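/- \textbf{Theorem (Regret Bound for Randomized Policies).} Let $\mathcal X$ be a compact metric space and $f:\mathcal X\to\mathbb R$ continuous. Put $\Delta(x)=\max_{x'\in\mathcal X}f(x')-f(x)$ and $S=\max_{x\in\mathcal X}\Delta(x)$. Let $\pi=(\pi_t)_{t\ge1}$ be any (possibly randomized) policy, i.e. a sequence of measurable maps $\pi_t$ from $(\mathcal X\times\mathbb R)^{t-1}$ to the Borel probability measures on $\mathcal X$, and let $(\epsilon_t)_{t\ge1}$ be any real-valued noise process. Let $(x_t,y_t)_{t\ge1}$ be the resulting process: $y_t=f(x_t)+\epsilon_t$ and, conditionally on $\mathcal F_{t-1}=\sigma(x_1,y_1,\dots,x_{t-1},y_{t-1})$, $x_t\sim\pi_t(x_1,y_1,\dots,x_{t-1},y_{t-1})$. The regret is $R_T=\max_{x\in\mathcal X}\sum_{t=1}^T\big(f(x)-f(x_t)\big)$. Let $I_t:(\mathcal X\times\mathbb R)^{t-1}\times\mathcal X\to[0,\infty)$, $t\ge1$, be continuous functions, write $I_t(x)=I_t(x_1,y_1,\dots,x_{t-1},y_{t-1},x)$, and define $$\gamma_T=\operatorname{ess\,sup}\sum_{t=1}^T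 I_t(x_t)\in[0,\infty],\qquad \Psi_t=\frac{\Big(\int_{\mathcal X}\Delta(x)\,\pi_t(dx)\Big)^2}{\int_{\mathcal X}I_t(x)\,\pi_t(dx)}\in[0,\infty],$$ where $\pi_t$ stands for $\pi_t(x_1,y_1,\dots,x_{t-1},y_{t-1})$, $a/0=\infty$ for $a>0$ and $0/0=0$. In the bounds below a factor in large parentheses is read as $\infty$ if $\gamma_T=\infty$, with $0\cdot\infty=0$ and $0\log 0=0$. Then for every $\delta\in(0,1)$, with probability at least $1-\delta$, simultaneously for all $T\ge1$, $$R_T\le\tfrac54\sqrt{\sum_{t=1}^T\Psi_t\,\Big(2\gamma_T+4\gamma_T\log\tfrac2\delta+8\gamma_T\log(4\gamma_T)+1\Big)}+4S\log\Big(\tfrac{8\pi^2T^2}{3\delta}(\log T+1)\Big).$$ (In the logarithm, $\pi$ is the number $\pi$; each square root is taken of the product of $\sum_{t=1}^T\Psi_t$ with the factor in parentheses.) If moreover $I_t(x_t)\le1$ almost surely for all $t\ge1$, then, with probability at least $1-\delta$, simultaneously for all $T\ge1$, $$R_T\le\tfrac54\sqrt{\sum_{t=1}^T\Psi_t\,\Big(2\gamma_T+4\log\tfrac2\delta+8\log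 4+1\Big)}+4S\log\Big(\tfrac{8\pi^2T^2}{3\delta}(\log T+1)\Big).$$ -/

import Mathlib

open MeasureTheory ProbabilityTheory
open scoped ENNReal NNReal

namespace Bandit

/-- Histories of `t` past rounds: the pairs `(action, observation)` of rounds `0, …, t - 1`.
Rounds are numbered from `0`, so that round `t` is preceded by a history of length `t`. -/
abbrev History (X : Type*) (t : ℕ) : Type _ := Fin t → X × ℝ

/-- A (possibly randomized) policy: for every round `t`, a (measurable) map from histories of
length `t` to Borel probability measures on the action set. -/
structure Policy (X : Type*) [MeasurableSpace X] where
  dist : ∀ t : ℕ, Kernel (History X t) X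
  isMarkov : ∀ t, IsMarkovKernel (dist t)

/-- A sequence of non-negative continuous information gain functions
`I t (history of length t, action)`. -/
abbrev InfoGain (X : Type*) [TopologicalSpace X] : Type _ :=
  ∀ t : ℕ, C(History X t × X, ℝ≥0)

section

variable {X Ω : Type*}

/-- The history of the first `t` rounds along a sequence of actions `x` and observations `y`. -/
def hist (x : ℕ → Ω → X) (y : ℕ → Ω → ℝ) (t : ℕ) (ω : Ω) : History X t :=
  fun s => (x s ω, y s ω)

/-- `x`, `y` are the actions and observations that arise when policy `π` interacts with the reward
function `f` under the noise process `ε`: the observations are `y t = f (x t) + ε t`, and given the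
history of the previous rounds, `x t` is distributed according to `π`. Nothing is assumed about
the noise except that it is a real-valued process. -/
structure IsInteraction [MeasurableSpace X] [MeasurableSpace Ω] (P : Measure Ω)
    (f : X → ℝ) (π : Policy X) (x : ℕ → Ω → X) (ε y : ℕ → Ω → ℝ) : Prop where
  measurable_action : ∀ t, Measurable (x t)
  measurable_noise : ∀ t, Measurable (ε t)
  obs_eq : ∀ t ω, y t ω = f (x t ω) + ε t ω
  action_law : ∀ t, HasCondDistrib (x t) (hist x y t) (π.dist t) P

/-- The sub-optimality gap `Δ(a) = max f - f(a)`. -/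
noncomputable def gap (f : X → ℝ) (a : X) : ℝ := (⨆ a', f a') - f a

/-- `S`, the maximum of the sub-optimality gaps. -/
noncomputable def maxGap (f : X → ℝ) : ℝ := ⨆ a, gap f a

/-- The regret after `T` rounds, `R_T = max_a ∑_{t < T} (f(a) - f(x_t))`. -/
noncomputable def regret (f : X → ℝ) (x : ℕ → Ω → X) (T : ℕ) (ω : Ω) : ℝ :=
  ⨆ a, ∑ t ∈ Finset.range T, (f a - f (x t ω))

/-- The maximum information gain `γ_T`: the essential supremum, over the process, of the
total information gain of the first `T` rounds. It may be `∞`. -/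
noncomputable def maxInfoGain [TopologicalSpace X] [MeasurableSpace Ω] (P : Measure Ω)
    (I : InfoGain X) (x : ℕ → Ω → X) (y : ℕ → Ω → ℝ) (T : ℕ) : ℝ≥0∞ :=
  essSup (fun ω => ∑ t ∈ Finset.range T, (I t (hist x y t ω, x t ω) : ℝ≥0∞)) P

/-- The regret-information ratio `(E_μ Δ)² / E_μ g` of a distribution `μ` on actions, with values in
`[0, ∞]`. By the conventions of `ℝ≥0∞`, it is `∞` if `E_μ g = 0 < E_μ Δ`, and `0` if both
expectations vanish. -/
noncomputable def infoRatio [MeasurableSpace X] (f : X → ℝ) (g : X → ℝ≥0) (μ : Measure X) : ℝ≥0∞ :=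
  (∫⁻ a, ENNReal.ofReal (gap f a) ∂μ) ^ 2 / ∫⁻ a, (g a : ℝ≥0∞) ∂μ

/-- `Ψ_t`: the regret-information ratio at round `t` of the sampling distribution that the policy
uses after the observed history. -/
noncomputable def policyRatio [TopologicalSpace X] [MeasurableSpace X] (f : X → ℝ) (π : Policy X)
    (I : InfoGain X) (x : ℕ → Ω → X) (y : ℕ → Ω → ℝ) (t : ℕ) (ω : Ω) : ℝ≥0∞ :=
  infoRatio f (fun a => I t (hist x y t ω, a)) (π.dist t (hist x y t ω))

end

/-- The factor `2γ + 4γ log(2/δ) + 8γ log(4γ) + 1`, read as `∞` for `γ = ∞` and as `1` for `γ = 0`.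
It is positive for every `0 ≤ γ < ∞` and `0 < δ < 1`. -/
noncomputable def infoFactor (γ : ℝ≥0∞) (δ : ℝ) : ℝ≥0∞ :=
  if γ = ∞ then ∞ else
    ENNReal.ofReal (2 * γ.toReal + 4 * γ.toReal * Real.log (2 / δ)
      + 8 * γ.toReal * Real.log (4 * γ.toReal) + 1)

/-- The factor `2γ + 4 log(2/δ) + 8 log 4 + 1`, read as `∞` for `γ = ∞`. -/
noncomputable def infoFactorOne (γ : ℝ≥0∞) (δ : ℝ) : ℝ≥0∞ :=
  if γ = ∞ then ∞ else
    ENNReal.ofReal (2 * γ.toReal + 4 * Real.log (2 / δ) + 8 * Real.log 4 + 1)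

end Bandit

/-! Let `m_t` and `M_t` be the conditional means, given the past, of the gap and of the information
gain of the action of round `t`. Since `m_t = √Ψ_t · √M_t`, up to degenerate values, Cauchy–Schwarz
gives `∑ m_t ≤ √(∑ Ψ_t · ∑ M_t)`. It remains to compare sums with sums of conditional means twice,
each time with failure probability `δ/2`.

Both comparisons are Ville's inequality for an exponential supermartingale
(`measure_exists_log_le`). For the gaps, `exp v ≤ 1 + 5v/4` on `[0, 1/4]` with `v = Δ/(4S)` produces
the constants `5/4` and `4S`. For the gains, `exp (-v) ≤ 1 - v/2` on `[0, 1]` with `v = w_t I_t`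
bounds `∑ w_t M_t / 2`. When `I_t ≤ 1`, `w_t = 1` works. In general `w_t` is the inverse of
`γ_{t+1}` with a positive floor; these weights are deterministic and do not depend on the horizon,
and undoing them costs a logarithm (`sum_div_le_log`). -/

namespace Bandit

/-! ### Stopped products -/

section StoppedProd

variable {X Ω : Type*} {x : ℕ → Ω → X} {y : ℕ → Ω → ℝ}

/-- The product of the factors `F s`, as a function of the history, frozen as soon as it
reaches the level `c`. -/
noncomputable def stoppedProd (F : ∀ t, History X t × X → ℝ≥0∞) (c : ℝ≥0∞) :
    ∀ n, History X n → ℝ≥0∞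
  | 0, _ => 1
  | n + 1, h =>
    if c ≤ stoppedProd F c n (fun s => h s.castSucc) then
      stoppedProd F c n (fun s => h s.castSucc)
    else
      stoppedProd F c n (fun s => h s.castSucc)
        * F n (fun s => h s.castSucc, (h (Fin.last n)).1)

lemma stoppedProd_succ_hist (F : ∀ t, History X t × X → ℝ≥0∞) (c : ℝ≥0∞) (n : ℕ) (ω : Ω) :
    stoppedProd F c (n + 1) (hist x y (n + 1) ω) =
      if c ≤ stoppedProd F c n (hist x y n ω) then stoppedProd F c n (hist x y n ω)
      else stoppedProd F c n (hist x y n ω) * F n (hist x y n ω, x n ω) := rfl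

lemma le_stoppedProd_or (F : ∀ t, History X t × X → ℝ≥0∞) (c : ℝ≥0∞) (n : ℕ) (ω : Ω) :
    c ≤ stoppedProd F c n (hist x y n ω) ∨
      stoppedProd F c n (hist x y n ω) = ∏ t ∈ Finset.range n, F t (hist x y t ω, x t ω) := by
  induction n with
  | zero => right; rfl
  | succ n ih =>
    rw [stoppedProd_succ_hist]
    split_ifs with h
    · exact Or.inl h
    · right
      rw [ih.resolve_left h, Finset.prod_range_succ]

end StoppedProd

/-! ### Supermartingales along the interaction and Ville's inequality -/

section Interaction

variable {X Ω : Type*} [MeasurableSpace X] [MeasurableSpace Ω] {P : Measure Ω}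
  {f : X → ℝ} {π : Policy X} {x : ℕ → Ω → X} {ε y : ℕ → Ω → ℝ}

lemma IsInteraction.measurable_obs (h : IsInteraction P f π x ε y) (hf : Measurable f) (t : ℕ) :
    Measurable (y t) := by
  have : y t = fun ω => f (x t ω) + ε t ω := funext (h.obs_eq t)
  rw [this]
  exact (hf.comp (h.measurable_action t)).add (h.measurable_noise t)

lemma IsInteraction.measurable_hist (h : IsInteraction P f π x ε y) (hf : Measurable f) (t : ℕ) :
    Measurable (hist x y t) :=
  measurable_pi_lambda _ fun s =>
    (h.measurable_action s).prodMk (h.measurable_obs hf s)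

lemma IsInteraction.lintegral_action [IsProbabilityMeasure P] (h : IsInteraction P f π x ε y)
    (hf : Measurable f) (t : ℕ) {g : History X t × X → ℝ≥0∞} (hg : Measurable g) :
    ∫⁻ ω, g (hist x y t ω, x t ω) ∂P
      = ∫⁻ ω, ∫⁻ a, g (hist x y t ω, a) ∂(π.dist t (hist x y t ω)) ∂P := by
  have := π.isMarkov t
  have hm := h.measurable_hist hf t
  rw [← lintegral_map hg (hm.prodMk (h.measurable_action t)), (h.action_law t).map_eq,
    Measure.lintegral_compProd hg, lintegral_map hg.lintegral_kernel_prod_right' hm]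

/-- Bounds on the information gain are known only at the action played, whereas exponential moments
integrate over the whole sampling distribution. The joint law of history and action is the
composition product, which transfers one to the other. -/
lemma IsInteraction.ae_action [IsProbabilityMeasure P] (h : IsInteraction P f π x ε y)
    (hf : Measurable f) (t : ℕ) {p : History X t × X → Prop} (hp : MeasurableSet {z | p z})
    (hae : ∀ᵐ ω ∂P, p (hist x y t ω, x t ω)) :
    ∀ᵐ ω ∂P, ∀ᵐ a ∂(π.dist t (hist x y t ω)), p (hist x y t ω, a) := by
  have := π.isMarkov t
  have hm := h.measurable_hist hf t
  have h1 : ∀ᵐ z ∂(P.map fun ω => (hist x y t ω, x t ω)), p z :=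
    (ae_map_iff (hm.prodMk (h.measurable_action t)).aemeasurable hp).2 hae
  rw [(h.action_law t).map_eq] at h1
  exact ae_of_ae_map hm.aemeasurable (Measure.ae_ae_of_ae_compProd h1)

lemma measurable_stoppedProd {F : ∀ t, History X t × X → ℝ≥0∞} (hF : ∀ t, Measurable (F t))
    (c : ℝ≥0∞) (n : ℕ) : Measurable (stoppedProd F c n) := by
  induction n with
  | zero => exact measurable_const
  | succ n ih =>
    have hi : Measurable fun h : History X (n + 1) => fun s : Fin n => h s.castSucc :=
      measurable_pi_lambda _ fun s => measurable_pi_apply _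
    have hl : Measurable fun h : History X (n + 1) => (h (Fin.last n)).1 :=
      (measurable_pi_apply _).fst
    have hV := ih.comp hi
    exact Measurable.ite (measurableSet_le measurable_const hV) hV
      (hV.mul ((hF n).comp (hi.prodMk hl)))

lemma lintegral_stoppedProd_le [IsProbabilityMeasure P] (h : IsInteraction P f π x ε y)
    (hf : Measurable f) {F : ∀ t, History X t × X → ℝ≥0∞} (hF : ∀ t, Measurable (F t))
    (hF1 : ∀ t, ∀ᵐ ω ∂P, ∫⁻ a, F t (hist x y t ω, a) ∂(π.dist t (hist x y t ω)) ≤ 1)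
    (c : ℝ≥0∞) (n : ℕ) : ∫⁻ ω, stoppedProd F c n (hist x y n ω) ∂P ≤ 1 := by
  induction n with
  | zero => simp [stoppedProd]
  | succ n ih =>
    refine le_trans ?_ ih
    have := π.isMarkov n
    have hV := measurable_stoppedProd hF c n
    have hG : Measurable fun z : History X n × X =>
        if c ≤ stoppedProd F c n z.1 then stoppedProd F c n z.1
        else stoppedProd F c n z.1 * F n z :=
      Measurable.ite (measurableSet_le measurable_const (hV.comp measurable_fst))
        (hV.comp measurable_fst) ((hV.comp measurable_fst).mul (hF n))
    simp only [stoppedProd_succ_hist]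
    rw [h.lintegral_action hf n hG]
    refine lintegral_mono_ae ?_
    filter_upwards [hF1 n] with ω hω
    by_cases hc : c ≤ stoppedProd F c n (hist x y n ω)
    · simp [hc]
    · simp only [hc, if_false]
      rw [lintegral_const_mul _ (show Measurable fun a => F n (hist x y n ω, a) from
        (hF n).comp measurable_prodMk_left)]
      exact mul_le_of_le_one_right' hω

/-- Ville's maximal inequality for products of factors of conditional mean at most one. -/
lemma IsInteraction.measure_exists_le_prod [IsProbabilityMeasure P]
    (h : IsInteraction P f π x ε y) (hf : Measurable f)
    {F : ∀ t, History X t × X → ℝ≥0∞} (hF : ∀ t, Measurable (F t))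
    (hF1 : ∀ t, ∀ᵐ ω ∂P, ∫⁻ a, F t (hist x y t ω, a) ∂(π.dist t (hist x y t ω)) ≤ 1)
    {c : ℝ≥0∞} (hc : c ≠ 0) (hc' : c ≠ ∞) :
    P {ω | ∃ n, c ≤ ∏ t ∈ Finset.range n, F t (hist x y t ω, x t ω)} ≤ c⁻¹ := by
  have hsub : {ω | ∃ n, c ≤ ∏ t ∈ Finset.range n, F t (hist x y t ω, x t ω)}
      ⊆ ⋃ n, {ω | c ≤ stoppedProd F c n (hist x y n ω)} := by
    rintro ω ⟨n, hn⟩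
    refine Set.mem_iUnion.2 ⟨n, ?_⟩
    rcases le_stoppedProd_or (x := x) (y := y) F c n ω with h | h
    · exact h
    · exact hn.trans_eq h.symm
  -- Freezing makes the events increase with `n`, so the union is handled by continuity from below,
  -- and Markov's inequality suffices for each `n`.
  have hmono : Monotone fun n => {ω | c ≤ stoppedProd F c n (hist x y n ω)} := by
    refine monotone_nat_of_le_succ fun n ω hω => ?_
    have hω : c ≤ stoppedProd F c n (hist x y n ω) := hω
    change c ≤ stoppedProd F c (n + 1) (hist x y (n + 1) ω)
    rwa [stoppedProd_succ_hist, if_pos hω]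
  refine (measure_mono hsub).trans ?_
  rw [hmono.measure_iUnion]
  refine iSup_le fun n => ?_
  have hV := (measurable_stoppedProd hF c n).comp (h.measurable_hist hf n)
  have := (mul_meas_ge_le_lintegral₀ (μ := P) hV.aemeasurable c).trans
    (lintegral_stoppedProd_le h hf hF hF1 c n)
  rw [← one_div, ENNReal.le_div_iff_mul_le (Or.inl hc) (Or.inl hc'), mul_comm]
  exact this

/-- Integrating the linear bound gives `E exp u ≤ 1 + r E u ≤ exp (r E u)`. The sign of `u` is free,
so upper and lower deviations are both covered. -/
lemma lintegral_exp_sub_le_one {μ : Measure X} [IsProbabilityMeasure μ] {u : X → ℝ} {r : ℝ}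
    (hu : Integrable u μ) (hexp : ∀ᵐ a ∂μ, Real.exp (u a) ≤ 1 + r * u a) :
    ∫⁻ a, ENNReal.ofReal (Real.exp (u a - r * ∫ b, u b ∂μ)) ∂μ ≤ 1 := by
  set m := ∫ b, u b ∂μ
  have hint : Integrable (fun a => (1 + r * u a) * Real.exp (-(r * m))) μ :=
    ((integrable_const 1).add (hu.const_mul r)).mul_const _
  have hle : ∀ᵐ a ∂μ, Real.exp (u a - r * m) ≤ (1 + r * u a) * Real.exp (-(r * m)) := by
    filter_upwards [hexp] with a ha
    rw [sub_eq_add_neg, Real.exp_add]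
    gcongr
  calc ∫⁻ a, ENNReal.ofReal (Real.exp (u a - r * m)) ∂μ
      ≤ ∫⁻ a, ENNReal.ofReal ((1 + r * u a) * Real.exp (-(r * m))) ∂μ :=
        lintegral_mono_ae (hle.mono fun a ha => ENNReal.ofReal_le_ofReal ha)
    _ = ENNReal.ofReal (∫ a, (1 + r * u a) * Real.exp (-(r * m)) ∂μ) :=
        (ofReal_integral_eq_lintegral_ofReal hint
          (hle.mono fun a ha => (Real.exp_pos _).le.trans ha)).symm
    _ = ENNReal.ofReal ((1 + r * m) * Real.exp (-(r * m))) := by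
        rw [integral_mul_const, integral_add (integrable_const 1) (hu.const_mul r),
          integral_const_mul]
        simp [m]
    _ ≤ 1 := by
        rw [← ENNReal.ofReal_one]
        refine ENNReal.ofReal_le_ofReal ?_
        rw [Real.exp_neg, ← div_eq_mul_inv, div_le_one (Real.exp_pos _), add_comm]
        exact Real.add_one_le_exp _

/-- A time-uniform deviation inequality for an additive functional of the interaction. -/
lemma IsInteraction.measure_exists_log_le [IsProbabilityMeasure P]
    (h : IsInteraction P f π x ε y) (hf : Measurable f)
    {u : ∀ t, History X t × X → ℝ} (hu : ∀ t, Measurable (u t)) {r : ℝ}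
    (hint : ∀ t ω, Integrable (fun a => u t (hist x y t ω, a)) (π.dist t (hist x y t ω)))
    (hexp : ∀ t, ∀ᵐ ω ∂P, Real.exp (u t (hist x y t ω, x t ω))
      ≤ 1 + r * u t (hist x y t ω, x t ω))
    {c : ℝ} (hc : 0 < c) :
    P {ω | ∃ n, Real.log c ≤ ∑ t ∈ Finset.range n, (u t (hist x y t ω, x t ω)
      - r * ∫ a, u t (hist x y t ω, a) ∂(π.dist t (hist x y t ω)))} ≤ ENNReal.ofReal c⁻¹ := by
  have := π.isMarkov
  let F : ∀ t, History X t × X → ℝ≥0∞ := fun t z =>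
    ENNReal.ofReal (Real.exp (u t z - r * ∫ a, u t (z.1, a) ∂(π.dist t z.1)))
  have hF : ∀ t, Measurable (F t) := fun t =>
    (Real.measurable_exp.comp ((hu t).sub
      (((hu t).stronglyMeasurable.integral_kernel_prod_right'.measurable.comp
        measurable_fst).const_mul r))).ennreal_ofReal
  have hF1 : ∀ t, ∀ᵐ ω ∂P, ∫⁻ a, F t (hist x y t ω, a) ∂(π.dist t (hist x y t ω)) ≤ 1 := by
    intro t
    filter_upwards [h.ae_action hf t (measurableSet_le (Real.measurable_exp.comp (hu t))
      (((hu t).const_mul r).const_add 1)) (hexp t)] with ω hω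
    exact lintegral_exp_sub_le_one (hint t ω) hω
  have hV := h.measure_exists_le_prod hf hF hF1 (c := ENNReal.ofReal c)
    (by simpa using hc) ENNReal.ofReal_ne_top
  rw [ENNReal.ofReal_inv_of_pos hc]
  refine (measure_mono ?_).trans hV
  rintro ω ⟨n, hn⟩
  refine ⟨n, ?_⟩
  rw [← ENNReal.ofReal_prod_of_nonneg (fun _ _ => (Real.exp_pos _).le), ← Real.exp_sum]
  exact ENNReal.ofReal_le_ofReal ((Real.log_le_iff_le_exp hc).1 hn)

end Interaction

/-! ### Deterministic inequalities -/

/-- Summation by parts: as the partial sum is at most `G n`, changing its divisor from `G n` to `G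
(n + 1)` costs at most `1 - G n / G (n + 1) ≤ log (G (n + 1) / G n)`, and these logarithms
telescope. -/
lemma sum_div_le_log {s G : ℕ → ℝ} {n : ℕ} (hG0 : ∀ t ≤ n, 0 < G t)
    (hG : ∀ t < n, G t ≤ G (t + 1)) (hs : ∀ t < n, ∑ i ∈ Finset.range t, s i ≤ G t) :
    ∑ t ∈ Finset.range n, s t / G (t + 1)
      ≤ (∑ t ∈ Finset.range n, s t) / G n + Real.log (G n / G 0) := by
  induction n with
  | zero => simp [div_self (hG0 0 le_rfl).ne']
  | succ n ih =>
    have ih := ih (fun t ht => hG0 t (ht.trans n.le_succ)) (fun t ht => hG t (ht.trans n.lt_succ_self))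
      (fun t ht => hs t (ht.trans n.lt_succ_self))
    have h0 := hG0 0 (Nat.zero_le _)
    have hn := hG0 n n.le_succ
    have hn1 := hG0 (n + 1) le_rfl
    have hS := hs n n.lt_succ_self
    have hGn := hG n n.lt_succ_self
    rw [Finset.sum_range_succ, Finset.sum_range_succ, add_div]
    set S := ∑ t ∈ Finset.range n, s t
    have h1 : S / G n - S / G (n + 1) ≤ 1 - G n / G (n + 1) := by
      have e1 : S / G n - S / G (n + 1) = S * (1 / G n - 1 / G (n + 1)) := by ring
      have e2 : 1 - G n / G (n + 1) = G n * (1 / G n - 1 / G (n + 1)) := by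
        field_simp
      rw [e1, e2]
      exact mul_le_mul_of_nonneg_right hS (sub_nonneg.2 (one_div_le_one_div_of_le hn hGn))
    have h2 : 1 - G n / G (n + 1) ≤ Real.log (G (n + 1) / G n) := by
      have := Real.one_sub_inv_le_log_of_pos (div_pos hn1 hn)
      rwa [inv_div] at this
    have h3 : Real.log (G (n + 1) / G 0) = Real.log (G (n + 1) / G n) + Real.log (G n / G 0) := by
      rw [Real.log_div hn1.ne' h0.ne', Real.log_div hn1.ne' hn.ne', Real.log_div hn.ne' h0.ne']
      ring
    linarith

/-- The minimum of `u log u` is `-1/e`, and `2/e < 3/4`. -/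
lemma neg_three_quarters_le_mul_log {z : ℝ} (hz : 0 ≤ z) :
    -(3 / 4) ≤ 8 * z * Real.log (4 * z) := by
  rcases hz.eq_or_lt with rfl | hz
  · norm_num
  have h := Real.add_one_le_exp (-Real.log (4 * z) - 1)
  rw [sub_eq_add_neg, Real.exp_add, Real.exp_neg, Real.exp_log (by positivity)] at h
  have he := Real.exp_neg_one_lt_d9
  have h4 : 0 < 4 * z := by positivity
  have h5 : -Real.log (4 * z) * (4 * z) ≤ Real.exp (-1) := by
    have := mul_le_mul_of_nonneg_right h h4.le
    have e : (4 * z)⁻¹ * Real.exp (-1) * (4 * z) = Real.exp (-1) := by field_simp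
    rw [e] at this
    linarith
  linarith

lemma max_mul_log_le_infoFactor {γ l : ℝ} (hγ : 0 ≤ γ) (hl : 0 < l) :
    2 * max γ (1 / (8 * l)) * l + 2 * max γ (1 / (8 * l)) * Real.log (max γ (1 / (8 * l)) /
      (1 / (8 * l))) ≤ 4 * γ * l + 8 * γ * Real.log (4 * γ) + 1 := by
  have hk : 0 < 1 / (8 * l) := by positivity
  rcases le_total γ (1 / (8 * l)) with h | h
  -- At the floor the left side is `1/4`, exactly what the `+ 1` leaves after the worst case `-3/4`
  -- of the logarithmic term.
  · rw [max_eq_right h, div_self hk.ne', Real.log_one]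
    have := neg_three_quarters_le_mul_log hγ
    have e : 2 * (1 / (8 * l)) * l = 1 / 4 := by field_simp; norm_num
    have : 0 ≤ 4 * γ * l := by positivity
    linarith
  · rw [max_eq_left h]
    have hγ : 0 < γ := hk.trans_le h
    -- Here `log (2l) ≤ l` is absorbed by doubling `2γl`; the unused `6γ log (4γ)` is at least `-1`.
    have e : γ / (1 / (8 * l)) = (4 * γ) * (2 * l) := by field_simp; norm_num
    rw [e, Real.log_mul (by positivity) (by positivity), Real.log_mul (by norm_num) hl.ne']
    have h1 := Real.log_le_sub_one_of_pos hl
    have h2 : Real.log 2 ≤ 1 := by linarith [Real.log_two_lt_d9]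
    have h3 : -1 ≤ 6 * γ * Real.log (4 * γ) := by
      linarith [neg_three_quarters_le_mul_log hγ.le]
    have h4 : γ * (Real.log 2 + Real.log l) ≤ γ * l :=
      mul_le_mul_of_nonneg_left (by linarith) hγ.le
    linarith

lemma sum_le_sqrt_ratio {ι : Type*} (s : Finset ι) {a b : ι → ℝ≥0∞} {K : ℝ≥0∞}
    (hb : ∀ i ∈ s, b i ≠ ∞) (hK0 : K ≠ 0) (hK : ∑ i ∈ s, b i ≤ K) :
    ∑ i ∈ s, a i ≤ ((∑ i ∈ s, a i ^ 2 / b i) * K) ^ (1 / 2 : ℝ) := by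
  -- An infinite ratio makes the right side infinite only because `K ≠ 0`; this is why the factors
  -- must be shown positive.
  by_cases hΨ : ∃ i ∈ s, a i ^ 2 / b i = ∞
  · rw [show ∑ i ∈ s, a i ^ 2 / b i = ∞ from ENNReal.sum_eq_top.2 hΨ, ENNReal.top_mul hK0,
      ENNReal.top_rpow_of_pos (by norm_num)]
    exact le_top
  push Not at hΨ
  have key : ∀ i ∈ s, a i ≤ (a i ^ 2 / b i) ^ (1 / 2 : ℝ) * b i ^ (1 / 2 : ℝ) := by
    intro i hi
    rw [← ENNReal.mul_rpow_of_nonneg _ _ (by norm_num)]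
    have h2 : a i ^ 2 ≤ a i ^ 2 / b i * b i := by
      by_cases h0 : b i = 0
      · have := hΨ i hi
        rw [h0] at this ⊢
        have ha : a i ^ 2 = 0 := by
          by_contra h
          exact this (ENNReal.div_zero h)
        simp [ha]
      · rw [ENNReal.div_mul_cancel h0 (hb i hi)]
    calc a i = (a i ^ 2) ^ (1 / 2 : ℝ) := by
          rw [← ENNReal.rpow_natCast, ← ENNReal.rpow_mul]; norm_num
      _ ≤ _ := ENNReal.rpow_le_rpow h2 (by norm_num)
  refine (Finset.sum_le_sum key).trans ?_
  refine (ENNReal.inner_le_Lp_mul_Lq s _ _ Real.HolderConjugate.two_two).trans ?_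
  simp only [← ENNReal.rpow_mul]
  norm_num
  rw [← ENNReal.mul_rpow_of_nonneg _ _ (by norm_num)]
  gcongr

/-! ### Gaps, exponential bounds and the maximum information gain -/

section Gap

lemma continuous_gap {X : Type*} [TopologicalSpace X] {f : X → ℝ} (hf : Continuous f) :
    Continuous (gap f) := continuous_const.sub hf

variable {X : Type*} [TopologicalSpace X] [CompactSpace X] {f : X → ℝ}

lemma gap_nonneg (hf : Continuous f) (a : X) : 0 ≤ gap f a :=
  sub_nonneg.2 (le_ciSup (isCompact_range hf).bddAbove a)

lemma gap_le_maxGap (hf : Continuous f) (a : X) : gap f a ≤ maxGap f :=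
  le_ciSup (isCompact_range (continuous_gap hf)).bddAbove a

lemma regret_le_sum_gap {Ω : Type*} [Nonempty X] (hf : Continuous f) (x : ℕ → Ω → X) (T : ℕ)
    (ω : Ω) : regret f x T ω ≤ ∑ t ∈ Finset.range T, gap f (x t ω) :=
  ciSup_le fun a => Finset.sum_le_sum fun _ _ =>
    sub_le_sub_right (le_ciSup (isCompact_range hf).bddAbove a) _

end Gap

/-- Use `exp v ≥ 1 + v` and `(1 + v)(1 - v/2) = 1 + v(1 - v)/2 ≥ 1`. -/
lemma exp_neg_le_one_sub_half {v : ℝ} (h0 : 0 ≤ v) (h1 : v ≤ 1) : Real.exp (-v) ≤ 1 - v / 2 := by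
  have h := Real.add_one_le_exp v
  rw [Real.exp_neg]
  calc (Real.exp v)⁻¹ ≤ (v + 1)⁻¹ := inv_anti₀ (by linarith) h
    _ ≤ 1 - v / 2 := by
      rw [inv_le_iff_one_le_mul₀ (by linarith)]
      nlinarith

lemma exp_le_one_add_five_quarters {v : ℝ} (h0 : 0 ≤ v) (h1 : v ≤ 1 / 4) :
    Real.exp v ≤ 1 + 5 / 4 * v := by
  have h := (abs_le.1 (Real.abs_exp_sub_one_sub_id_le (x := v)
    (by rw [abs_of_nonneg h0]; linarith))).2
  nlinarith

section MaxInfoGain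

variable {X Ω : Type*} [TopologicalSpace X] [MeasurableSpace Ω]

lemma maxInfoGain_mono (P : Measure Ω) (I : InfoGain X) (x : ℕ → Ω → X) (y : ℕ → Ω → ℝ) :
    Monotone (maxInfoGain P I x y) := fun _ _ hmn =>
  essSup_mono_ae <| Filter.Eventually.of_forall fun _ => Finset.sum_le_sum_of_subset (Finset.range_mono hmn)

lemma ae_sum_infoGain_le (P : Measure Ω) (I : InfoGain X) (x : ℕ → Ω → X) (y : ℕ → Ω → ℝ) :
    ∀ᵐ ω ∂P, ∀ T, maxInfoGain P I x y T ≠ ∞ →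
      ∑ t ∈ Finset.range T, (I t (hist x y t ω, x t ω) : ℝ) ≤ (maxInfoGain P I x y T).toReal := by
  rw [ae_all_iff]
  intro T
  filter_upwards [ENNReal.ae_le_essSup (μ := P)
    (fun ω => ∑ t ∈ Finset.range T, (I t (hist x y t ω, x t ω) : ℝ≥0∞))] with ω hω hT
  have := ENNReal.toReal_mono hT hω
  rwa [ENNReal.toReal_sum (fun _ _ => ENNReal.coe_ne_top)] at this

end MaxInfoGain

/-! ### The two high-probability events -/

section Events

variable {X Ω : Type*} [MetricSpace X] [CompactSpace X] [MeasurableSpace X] [BorelSpace X]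
  [MeasurableSpace Ω] {P : Measure Ω} [IsProbabilityMeasure P]
  {f : X → ℝ} {π : Policy X} {x : ℕ → Ω → X} {ε y : ℕ → Ω → ℝ}

lemma measurable_infoGain (I : InfoGain X) (t : ℕ) :
    Measurable fun z : History X t × X => (I t z : ℝ) :=
  (NNReal.continuous_coe.comp (I t).continuous).measurable

lemma integrable_of_continuous {μ : Measure X} [IsProbabilityMeasure μ] {g : X → ℝ}
    (hg : Continuous g) : Integrable g μ := by
  simpa using hg.continuousOn.integrableOn_compact (μ := μ) isCompact_univ

lemma integrable_infoGain (I : InfoGain X) (π : Policy X) (t : ℕ) (h : History X t) :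
    Integrable (fun a => (I t (h, a) : ℝ)) (π.dist t h) :=
  have := π.isMarkov t
  integrable_of_continuous
    (NNReal.continuous_coe.comp ((I t).continuous.comp (by fun_prop)))

lemma lintegral_infoGain (I : InfoGain X) (π : Policy X) (t : ℕ) (h : History X t) :
    ∫⁻ a, (I t (h, a) : ℝ≥0∞) ∂(π.dist t h)
      = ENNReal.ofReal (∫ a, (I t (h, a) : ℝ) ∂(π.dist t h)) := by
  rw [ofReal_integral_eq_lintegral_ofReal (integrable_infoGain I π t h)
    (Filter.Eventually.of_forall fun a => NNReal.coe_nonneg _)]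
  simp

/-- With high probability, the weighted conditional means of the information gain are controlled
by the weighted information gain, simultaneously for all rounds. -/
lemma IsInteraction.measure_infoGain_deviation (h : IsInteraction P f π x ε y)
    (hf : Continuous f) (I : InfoGain X) {w : ℕ → ℝ} (hw : ∀ t, 0 ≤ w t)
    (hI : ∀ t, ∀ᵐ ω ∂P, w t * I t (hist x y t ω, x t ω) ≤ 1) {c : ℝ} (hc : 0 < c) :
    P {ω | ∃ n, Real.log c ≤ ∑ t ∈ Finset.range n,
      (w t * (∫ a, (I t (hist x y t ω, a) : ℝ) ∂(π.dist t (hist x y t ω))) / 2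
        - w t * I t (hist x y t ω, x t ω))} ≤ ENNReal.ofReal c⁻¹ := by
  have key := h.measure_exists_log_le hf.measurable (u := fun t z => -w t * I t z) (r := 1 / 2)
    (fun t => (measurable_infoGain I t).const_mul _)
    (fun t ω => (integrable_infoGain I π t _).const_mul _)
    (fun t => by
      filter_upwards [hI t] with ω hω
      have := exp_neg_le_one_sub_half (mul_nonneg (hw t) (NNReal.coe_nonneg _)) hω
      rw [neg_mul]
      linarith) hc
  convert key using 7
  refine Finset.sum_congr rfl fun t _ => ?_
  rw [integral_const_mul]
  ring

/-- With high probability, the total gap of the actions is controlled by the conditional means of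
the gaps, simultaneously for all rounds. -/
lemma IsInteraction.measure_gap_deviation (h : IsInteraction P f π x ε y)
    (hf : Continuous f) {c : ℝ} (hc : 1 < c) :
    P {ω | ∃ n, 5 / 4 * (∑ t ∈ Finset.range n, ∫ a, gap f a ∂(π.dist t (hist x y t ω)))
      + 4 * maxGap f * Real.log c < ∑ t ∈ Finset.range n, gap f (x t ω)}
      ≤ ENNReal.ofReal c⁻¹ := by
  have := π.isMarkov
  obtain ⟨ω₀⟩ : Nonempty Ω := nonempty_of_isProbabilityMeasure P
  have hS0 : 0 ≤ maxGap f := (gap_nonneg hf (x 0 ω₀)).trans (gap_le_maxGap hf _)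
  rcases hS0.eq_or_lt with hS | hS
  -- Scaling by `1/(4S)` needs `S > 0`; for `S = 0` all gaps vanish and the event is empty.
  · have hg : ∀ a, gap f a = 0 := fun a =>
      le_antisymm ((gap_le_maxGap hf a).trans hS.symm.le) (gap_nonneg hf a)
    simp [hg, ← hS]
  have hcg := continuous_gap hf
  have key := h.measure_exists_log_le hf.measurable
    (u := fun t z => (4 * maxGap f)⁻¹ * gap f z.2) (r := 5 / 4)
    (fun t => (hcg.measurable.comp measurable_snd).const_mul _)
    (fun t ω => (integrable_of_continuous hcg).const_mul _)
    (fun t => Filter.Eventually.of_forall fun ω => by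
      refine exp_le_one_add_five_quarters
        (mul_nonneg (by positivity) (gap_nonneg hf _)) ?_
      rw [inv_mul_le_iff₀ (by positivity)]
      linarith [gap_le_maxGap hf (x t ω)]) (by linarith : 0 < c)
  refine (measure_mono ?_).trans key
  rintro ω ⟨n, hn⟩
  refine ⟨n, ?_⟩
  simp only [integral_const_mul]
  have e : ∑ t ∈ Finset.range n, ((4 * maxGap f)⁻¹ * gap f (x t ω)
        - 5 / 4 * ((4 * maxGap f)⁻¹ * ∫ a, gap f a ∂(π.dist t (hist x y t ω))))
      = (4 * maxGap f)⁻¹ * (∑ t ∈ Finset.range n, gap f (x t ω)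
        - 5 / 4 * ∑ t ∈ Finset.range n, ∫ a, gap f a ∂(π.dist t (hist x y t ω))) := by
    rw [Finset.mul_sum, ← Finset.sum_sub_distrib, Finset.mul_sum]
    exact Finset.sum_congr rfl fun _ _ => by ring
  rw [e, ← div_eq_inv_mul, le_div_iff₀ (by positivity)]
  linarith

/-- The sum of the conditional means of the information gain is at most `infoFactor`. -/
lemma IsInteraction.measure_infoFactor_lt (h : IsInteraction P f π x ε y)
    (hf : Continuous f) (I : InfoGain X) {δ : ℝ} (hδ : 0 < δ) (hδ' : δ < 1) :
    P {ω | ∃ T, infoFactor (maxInfoGain P I x y T) δ < ∑ t ∈ Finset.range T,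
      ∫⁻ a, (I t (hist x y t ω, a) : ℝ≥0∞) ∂(π.dist t (hist x y t ω))}
      ≤ ENNReal.ofReal (δ / 2) := by
  set l := Real.log (2 / δ) with hl
  have hl0 : 0 < l := Real.log_pos (by rw [lt_div_iff₀ hδ]; linarith)
  set γ := maxInfoGain P I x y
  have hγmono : Monotone γ := maxInfoGain_mono P I x y
  -- The floor keeps `G` positive when `γ` vanishes, as it does at time `0`; its value makes `2κl =
  -- 1/4`.
  set κ := 1 / (8 * l)
  have hκ : 0 < κ := by positivity
  let G : ℕ → ℝ := fun t => max (γ t).toReal κ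
  have hG : ∀ t, 0 < G t := fun t => hκ.trans_le (le_max_right _ _)
  -- The index is `t + 1` because `γ (t + 1)` is the first to include the gain of round `t`, so that
  -- the weighted gain is at most `1`. Rounds with infinite `γ (t + 1)` get weight `0`, which is
  -- harmless since the factor is then `∞`.
  let w : ℕ → ℝ := fun t => if γ (t + 1) = ∞ then 0 else 1 / G (t + 1)
  have hw : ∀ t, 0 ≤ w t := by
    intro t
    simp only [w]
    split_ifs
    · exact le_rfl
    · exact (one_div_pos.2 (hG _)).le
  have hbound := ae_sum_infoGain_le P I x y
  have hI : ∀ t, ∀ᵐ ω ∂P, w t * I t (hist x y t ω, x t ω) ≤ 1 := by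
    intro t
    filter_upwards [hbound] with ω hω
    simp only [w]
    split_ifs with ht
    · simp
    · rw [one_div, inv_mul_le_iff₀ (hG _), mul_one]
      refine le_trans ?_ ((hω (t + 1) ht).trans (le_max_left _ _))
      exact Finset.single_le_sum (f := fun t => (I t (hist x y t ω, x t ω) : ℝ))
        (fun _ _ => NNReal.coe_nonneg _) (Finset.self_mem_range_succ t)
  have key := h.measure_infoGain_deviation hf I hw hI (c := 2 / δ) (by positivity)
  rw [inv_div] at key
  refine le_trans (measure_mono_ae ?_) key
  filter_upwards [hbound] with ω hω
  rintro ⟨T, hT⟩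
  by_contra hcon
  have hcon : ¬ ∃ n, l ≤ ∑ t ∈ Finset.range n,
      (w t * (∫ a, (I t (hist x y t ω, a) : ℝ) ∂(π.dist t (hist x y t ω))) / 2
        - w t * I t (hist x y t ω, x t ω)) := hcon
  push Not at hcon
  have hT : infoFactor (γ T) δ < ∑ t ∈ Finset.range T,
      ∫⁻ a, (I t (hist x y t ω, a) : ℝ≥0∞) ∂(π.dist t (hist x y t ω)) := hT
  have hγT : γ T ≠ ∞ := by
    intro hinf
    simp [infoFactor, hinf] at hT
  have hfin : ∀ t ≤ T, γ t ≠ ∞ := fun t ht => ne_top_of_le_ne_top hγT (hγmono ht)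
  have hGmono : ∀ s t, s ≤ t → t ≤ T → G s ≤ G t := fun s t hst ht =>
    max_le_max (ENNReal.toReal_mono (hfin t ht) (hγmono hst)) le_rfl
  have hwT : ∀ t < T, w t = 1 / G (t + 1) := fun t ht => if_neg (hfin _ ht)
  set X' : ℕ → ℝ := fun t => I t (hist x y t ω, x t ω)
  set M : ℕ → ℝ := fun t => ∫ a, (I t (hist x y t ω, a) : ℝ) ∂(π.dist t (hist x y t ω))
  have hM0 : ∀ t, 0 ≤ M t := fun t => integral_nonneg fun a => NNReal.coe_nonneg _
  have h1 := hcon T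
  rw [Finset.sum_sub_distrib] at h1
  have h2 : ∑ t ∈ Finset.range T, w t * X' t
      ≤ (∑ t ∈ Finset.range T, X' t) / G T + Real.log (G T / G 0) := by
    refine le_trans (Finset.sum_le_sum fun t ht => ?_) (sum_div_le_log (s := X') (G := G) (n := T)
      (fun t _ => hG t) (fun t ht => hGmono _ _ t.le_succ ht)
      (fun t ht => (hω t (hfin t ht.le)).trans (le_max_left _ _)))
    rw [hwT t (Finset.mem_range.1 ht), one_div, div_eq_inv_mul]
  -- The weights decrease up to `T`, so each is at least `1 / G T`.
  have h3 : (∑ t ∈ Finset.range T, M t) / (2 * G T) ≤ ∑ t ∈ Finset.range T, w t * M t / 2 := by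
    rw [Finset.sum_div]
    refine Finset.sum_le_sum fun t ht => ?_
    have ht := Finset.mem_range.1 ht
    rw [hwT t ht, one_div, ← div_eq_inv_mul, div_div, mul_comm (2 : ℝ)]
    have := hG (t + 1)
    have := hM0 t
    gcongr
    exact hGmono _ _ ht le_rfl
  have hG0 : G 0 = κ := by
    have : γ 0 = 0 := by simp [γ, maxInfoGain]
    simp only [G, this, ENNReal.toReal_zero]
    exact max_eq_right hκ.le
  have h4 : ∑ t ∈ Finset.range T, M t
      ≤ 2 * (∑ t ∈ Finset.range T, X' t) + (2 * G T * l + 2 * G T * Real.log (G T / κ)) := by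
    rw [hG0] at h2
    have h5 : (∑ t ∈ Finset.range T, M t) / (2 * G T)
        ≤ l + ((∑ t ∈ Finset.range T, X' t) / G T + Real.log (G T / κ)) := by linarith
    rw [div_le_iff₀ (mul_pos two_pos (hG T))] at h5
    have e : (l + ((∑ t ∈ Finset.range T, X' t) / G T + Real.log (G T / κ))) * (2 * G T)
        = 2 * (∑ t ∈ Finset.range T, X' t)
          + (2 * G T * l + 2 * G T * Real.log (G T / κ)) := by
      have := (hG T).ne'
      field_simp
      ring
    linarith
  have h6 : 2 * G T * l + 2 * G T * Real.log (G T / κ)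
      ≤ 4 * (γ T).toReal * l + 8 * (γ T).toReal * Real.log (4 * (γ T).toReal) + 1 :=
    max_mul_log_le_infoFactor (γ := (γ T).toReal) ENNReal.toReal_nonneg hl0
  refine hT.not_ge ?_
  simp only [lintegral_infoGain]
  rw [← ENNReal.ofReal_sum_of_nonneg (fun t _ => hM0 t), infoFactor, if_neg hγT]
  refine ENNReal.ofReal_le_ofReal ?_
  have h7 : ∑ t ∈ Finset.range T, X' t ≤ (γ T).toReal := hω T hγT
  rw [← hl]
  change ∑ t ∈ Finset.range T, M t ≤ _
  linarith

/-- The sum of the conditional means of an information gain bounded by one is at most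
`infoFactorOne`. -/
lemma IsInteraction.measure_infoFactorOne_lt (h : IsInteraction P f π x ε y)
    (hf : Continuous f) (I : InfoGain X) {δ : ℝ} (hδ : 0 < δ) (hδ' : δ < 1)
    (hI : ∀ t : ℕ, ∀ᵐ ω ∂P, I t (hist x y t ω, x t ω) ≤ 1) :
    P {ω | ∃ T, infoFactorOne (maxInfoGain P I x y T) δ < ∑ t ∈ Finset.range T,
      ∫⁻ a, (I t (hist x y t ω, a) : ℝ≥0∞) ∂(π.dist t (hist x y t ω))}
      ≤ ENNReal.ofReal (δ / 2) := by
  have key := h.measure_infoGain_deviation hf I (w := fun _ => 1) (fun _ => zero_le_one)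
    (fun t => by
      filter_upwards [hI t] with ω hω
      rw [one_mul]
      exact_mod_cast hω) (c := 2 / δ) (by positivity)
  rw [inv_div] at key
  have hl0 : 0 < Real.log (2 / δ) := Real.log_pos (by rw [lt_div_iff₀ hδ]; linarith)
  refine le_trans (measure_mono_ae ?_) key
  filter_upwards [ae_sum_infoGain_le P I x y] with ω hω
  rintro ⟨T, hT⟩
  refine ⟨T, ?_⟩
  by_contra hcon
  rw [not_le, Finset.sum_sub_distrib, ← Finset.sum_div] at hcon
  simp only [one_mul] at hcon
  have hγT : maxInfoGain P I x y T ≠ ∞ := by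
    intro hinf
    simp [infoFactorOne, hinf] at hT
  refine hT.not_ge ?_
  simp only [lintegral_infoGain]
  rw [← ENNReal.ofReal_sum_of_nonneg (fun t _ => integral_nonneg fun a => NNReal.coe_nonneg _),
    infoFactorOne, if_neg hγT]
  refine ENNReal.ofReal_le_ofReal ?_
  have := hω T hγT
  have := Real.log_nonneg (show (1 : ℝ) ≤ 4 by norm_num)
  -- Unit weights give `2γ + 2 log (2/δ)`, below the stated factor.
  linarith

/-! ### Assembly of the regret bound -/

lemma infoFactor_ne_zero (γ : ℝ≥0∞) {δ : ℝ} (hδ : 0 < δ) (hδ' : δ < 1) :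
    infoFactor γ δ ≠ 0 := by
  unfold infoFactor
  split_ifs
  · exact ENNReal.top_ne_zero
  have hl0 : 0 < Real.log (2 / δ) := Real.log_pos (by rw [lt_div_iff₀ hδ]; linarith)
  have hγ := γ.toReal_nonneg
  have h := neg_three_quarters_le_mul_log hγ
  have : 0 ≤ 4 * γ.toReal * Real.log (2 / δ) := by positivity
  simp only [ne_eq, ENNReal.ofReal_eq_zero, not_le]
  linarith

lemma infoFactorOne_ne_zero (γ : ℝ≥0∞) {δ : ℝ} (hδ : 0 < δ) (hδ' : δ < 1) :
    infoFactorOne γ δ ≠ 0 := by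
  unfold infoFactorOne
  split_ifs
  · exact ENNReal.top_ne_zero
  have hl0 : 0 < Real.log (2 / δ) := Real.log_pos (by rw [lt_div_iff₀ hδ]; linarith)
  have := γ.toReal_nonneg
  have := Real.log_nonneg (show (1 : ℝ) ≤ 4 by norm_num)
  simp only [ne_eq, ENNReal.ofReal_eq_zero, not_le]
  linarith

/-- Ville's inequality is already uniform in time, so `log (2/δ)` suffices without a union bound
over `T`; the larger logarithm of the theorem follows by monotonicity. -/
lemma log_two_div_le {δ : ℝ} (hδ : 0 < δ) {T : ℕ} (hT : 1 ≤ T) :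
    Real.log (2 / δ)
      ≤ Real.log (8 * Real.pi ^ 2 * (T : ℝ) ^ 2 / (3 * δ) * (Real.log T + 1)) := by
  have hT : (1 : ℝ) ≤ T := by exact_mod_cast hT
  refine Real.log_le_log (by positivity) ?_
  have h1 : 1 ≤ Real.log T + 1 := by linarith [Real.log_nonneg hT]
  have h2 : (1 : ℝ) ≤ (T : ℝ) ^ 2 := one_le_pow₀ hT
  have h3 : 1 ≤ Real.pi ^ 2 := one_le_pow₀ (by linarith [Real.pi_gt_three])
  have h4 : 1 ≤ Real.pi ^ 2 * (T : ℝ) ^ 2 := one_le_mul_of_one_le_of_one_le h3 h2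
  calc 2 / δ = 6 / (3 * δ) := by field_simp; norm_num
    _ ≤ 8 * Real.pi ^ 2 * (T : ℝ) ^ 2 / (3 * δ) := by gcongr; linarith
    _ ≤ _ := le_mul_of_one_le_right (by positivity) h1

/-- The regret bound follows from a bound on the conditional means of the information gain. -/
lemma IsInteraction.le_measure_regret_le (h : IsInteraction P f π x ε y)
    (hf : Continuous f) (I : InfoGain X) {δ : ℝ} (hδ : 0 < δ) (hδ' : δ < 1) {K : ℕ → ℝ≥0∞}
    (hK0 : ∀ T, K T ≠ 0)
    (hK : P {ω | ∃ T, K T < ∑ t ∈ Finset.range T,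
      ∫⁻ a, (I t (hist x y t ω, a) : ℝ≥0∞) ∂(π.dist t (hist x y t ω))} ≤ ENNReal.ofReal (δ / 2)) :
    ENNReal.ofReal (1 - δ) ≤ P {ω | ∀ T : ℕ, 1 ≤ T →
      ENNReal.ofReal (regret f x T ω) ≤
        ENNReal.ofReal (5 / 4) *
            ((∑ t ∈ Finset.range T, policyRatio f π I x y t ω) * K T) ^ (1 / 2 : ℝ) +
          ENNReal.ofReal (4 * maxGap f *
            Real.log (8 * Real.pi ^ 2 * (T : ℝ) ^ 2 / (3 * δ) * (Real.log T + 1)))} := by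
  have := π.isMarkov
  obtain ⟨ω₀⟩ : Nonempty Ω := nonempty_of_isProbabilityMeasure P
  have hne : Nonempty X := ⟨x 0 ω₀⟩
  have hS0 : 0 ≤ maxGap f := (gap_nonneg hf (x 0 ω₀)).trans (gap_le_maxGap hf _)
  have hgap := h.measure_gap_deviation hf (c := 2 / δ) (by rw [lt_div_iff₀ hδ]; linarith)
  rw [inv_div] at hgap
  set A := {ω | ∃ T, K T < ∑ t ∈ Finset.range T,
      ∫⁻ a, (I t (hist x y t ω, a) : ℝ≥0∞) ∂(π.dist t (hist x y t ω))}
  set B := {ω | ∃ n, 5 / 4 * (∑ t ∈ Finset.range n, ∫ a, gap f a ∂(π.dist t (hist x y t ω)))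
      + 4 * maxGap f * Real.log (2 / δ) < ∑ t ∈ Finset.range n, gap f (x t ω)}
  set R := {ω | ∀ T : ℕ, 1 ≤ T → ENNReal.ofReal (regret f x T ω) ≤ _}
  have hsub : (A ∪ B)ᶜ ⊆ R := by
    intro ω hω T hT
    simp only [A, B, Set.mem_compl_iff, Set.mem_union, Set.mem_ofPred_eq, not_or, not_exists,
      not_lt] at hω
    have hA0 : ∀ t, 0 ≤ ∫ a, gap f a ∂(π.dist t (hist x y t ω)) := fun t =>
      integral_nonneg fun a => gap_nonneg hf a
    have h1 : regret f x T ω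
        ≤ 5 / 4 * (∑ t ∈ Finset.range T, ∫ a, gap f a ∂(π.dist t (hist x y t ω)))
          + 4 * maxGap f *
            Real.log (8 * Real.pi ^ 2 * (T : ℝ) ^ 2 / (3 * δ) * (Real.log T + 1)) := by
      refine ((regret_le_sum_gap hf x T ω).trans (hω.2 T)).trans ?_
      have := mul_le_mul_of_nonneg_left (log_two_div_le hδ hT) (by positivity : 0 ≤ 4 * maxGap f)
      linarith
    refine (ENNReal.ofReal_le_ofReal h1).trans (ENNReal.ofReal_add_le.trans ?_)
    gcongr
    rw [ENNReal.ofReal_mul (by norm_num), ENNReal.ofReal_sum_of_nonneg fun t _ => hA0 t]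
    gcongr
    refine le_trans (Finset.sum_le_sum fun t _ => ?_) (sum_le_sqrt_ratio (Finset.range T)
      (a := fun t => ∫⁻ a, ENNReal.ofReal (gap f a) ∂(π.dist t (hist x y t ω)))
      (b := fun t => ∫⁻ a, (I t (hist x y t ω, a) : ℝ≥0∞) ∂(π.dist t (hist x y t ω)))
      (fun t _ => ?_) (hK0 T) (hω.1 T))
    · exact (ofReal_integral_eq_lintegral_ofReal (integrable_of_continuous (continuous_gap hf))
        (Filter.Eventually.of_forall (gap_nonneg hf))).le
    · rw [lintegral_infoGain]
      exact ENNReal.ofReal_ne_top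
  have hbad : P (A ∪ B) ≤ ENNReal.ofReal δ := by
    refine (measure_union_le A B).trans ((add_le_add hK hgap).trans_eq ?_)
    rw [← ENNReal.ofReal_add (by positivity) (by positivity), add_halves]
  -- Subadditivity replaces the complement formula, so no event has to be measurable.
  have htot : 1 ≤ P R + ENNReal.ofReal δ := by
    calc 1 = P Set.univ := measure_univ.symm
      _ ≤ P ((A ∪ B)ᶜ ∪ (A ∪ B)) := by rw [Set.compl_union_self]
      _ ≤ P (A ∪ B)ᶜ + P (A ∪ B) := measure_union_le _ _
      _ ≤ P R + ENNReal.ofReal δ := add_le_add (measure_mono hsub) hbad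
  rw [ENNReal.ofReal_sub _ hδ.le, ENNReal.ofReal_one]
  exact tsub_le_iff_right.2 htot

end Events

end Bandit

theorem mainTheorem1
    {X : Type*} [MetricSpace X] [CompactSpace X] [MeasurableSpace X] [BorelSpace X]
    {Ω : Type*} [MeasurableSpace Ω] (P : Measure Ω) [IsProbabilityMeasure P]
    (f : X → ℝ) (hf : Continuous f)
    (I : Bandit.InfoGain X) (π : Bandit.Policy X)
    (x : ℕ → Ω → X) (ε y : ℕ → Ω → ℝ)
    (hxy : Bandit.IsInteraction P f π x ε y)
    (δ : ℝ) (hδ : 0 < δ) (hδ' : δ < 1) :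
    (ENNReal.ofReal (1 - δ) ≤ P {ω | ∀ T : ℕ, 1 ≤ T →
      ENNReal.ofReal (Bandit.regret f x T ω) ≤
        ENNReal.ofReal (5 / 4) *
            ((∑ t ∈ Finset.range T, Bandit.policyRatio f π I x y t ω) *
              Bandit.infoFactor (Bandit.maxInfoGain P I x y T) δ) ^ (1 / 2 : ℝ) +
          ENNReal.ofReal (4 * Bandit.maxGap f *
            Real.log (8 * Real.pi ^ 2 * (T : ℝ) ^ 2 / (3 * δ) * (Real.log T + 1)))}) ∧
    ((∀ t : ℕ, ∀ᵐ ω ∂P, I t (Bandit.hist x y t ω, x t ω) ≤ 1) →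
      ENNReal.ofReal (1 - δ) ≤ P {ω | ∀ T : ℕ, 1 ≤ T →
        ENNReal.ofReal (Bandit.regret f x T ω) ≤
          ENNReal.ofReal (5 / 4) *
              ((∑ t ∈ Finset.range T, Bandit.policyRatio f π I x y t ω) *
                Bandit.infoFactorOne (Bandit.maxInfoGain P I x y T) δ) ^ (1 / 2 : ℝ) +
            ENNReal.ofReal (4 * Bandit.maxGap f *
              Real.log (8 * Real.pi ^ 2 * (T : ℝ) ^ 2 / (3 * δ) * (Real.log T + 1)))}) := by
  refine ⟨?_, fun hI => ?_⟩
  · exact hxy.le_measure_regret_le hf I hδ hδ'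
      (fun T => Bandit.infoFactor_ne_zero _ hδ hδ') (hxy.measure_infoFactor_lt hf I hδ hδ')
  · exact hxy.le_measure_regret_le hf I hδ hδ'
      (fun T => Bandit.infoFactorOne_ne_zero _ hδ hδ') (hxy.measure_infoFactorOne_lt hf I hδ hδ' hI)
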